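/- For a Noetherian local ring $(R,\mathfrak m)$ of characteristic $p>0$, the Hilbert–Kunz multiplicity is \[ e_{HK}(R)=\lim_{e\to\infty}\frac{\lambda\bigl(R/\mathfrak m^{[p^e]}\bigr)}{p^{e\dim R}}, \] where $\lambda$ denotes length and $\mathfrak m^{[p^e]}$ is the ideal generated by all $p^e$-th powers of elements of $\mathfrak m$. Let $k$ be a field of characteristic $p>2$ and, for each $d\ge 0$, put \[ A_{p,d}=k[[x_0,\dots,x_d]]/(x_0^2+\cdots+x_d^2). \] Then for every integer $d\ge 1$ the limits defining $e_{HK}(A_{p,d})$ and $e_{HK}(A_{p,d+1})$ exist, and \[ e_{HK}(A_{p,d})>e_{HK}(A_{p,d+1}). \] -/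

import Mathlib

open Filter Topology

noncomputable section

/-- The Frobenius power `I^[q]` (used with `q = p ^ e`): the ideal generated by all `q`-th powers
of elements of `I`. -/
def frobeniusPower {R : Type*} [CommRing R] (I : Ideal R) (q : ℕ) : Ideal R :=
  Ideal.span ((fun x : R => x ^ q) '' (I : Set R))

/-- The Krull dimension of `R` as a natural number (it is finite for a Noetherian local ring). -/
def krullDimNat (R : Type*) [CommRing R] : ℕ :=
  ((ringKrullDim R).unbotD 0).toNat

/-- The `e`-th term `λ(R / m^[p^e]) / p^(e * dim R)` of the sequence whose limit is the
Hilbert--Kunz multiplicity of a Noetherian local ring `(R, m)` of characteristic `p > 0`;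
the length `λ` is finite for such a ring. -/
def hilbertKunzSeq (R : Type*) [CommRing R] [IsLocalRing R] (p e : ℕ) : ℝ :=
  ((Module.length R (R ⧸ frobeniusPower (IsLocalRing.maximalIdeal R) (p ^ e))).toNat : ℝ) /
    (p : ℝ) ^ (e * krullDimNat R)

/-- The Hilbert--Kunz multiplicity of a Noetherian local ring `R` of characteristic `p > 0`. -/
def hilbertKunzMultiplicity (R : Type*) [CommRing R] [IsLocalRing R] (p : ℕ) : ℝ :=
  limUnder atTop (hilbertKunzSeq R p)

/-- The quadric `x_0 ^ 2 + ⋯ + x_d ^ 2` in `k[[x_0, …, x_d]]`. -/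
def quadricForm (k : Type*) [Field k] (d : ℕ) : MvPowerSeries (Fin (d + 1)) k :=
  ∑ i, MvPowerSeries.X i ^ 2

/-- The ring `k[[x_0, …, x_d]] / (x_0 ^ 2 + ⋯ + x_d ^ 2)`. -/
abbrev QuadricRing (k : Type*) [Field k] (d : ℕ) : Type _ :=
  MvPowerSeries (Fin (d + 1)) k ⧸ Ideal.span {quadricForm k d}

instance quadricRing_nontrivial (k : Type*) [Field k] (d : ℕ) : Nontrivial (QuadricRing k d) := by
  refine Ideal.Quotient.nontrivial_iff.mpr fun h => ?_
  have hu := (Ideal.span_singleton_eq_top.mp h).map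
    (MvPowerSeries.constantCoeff (σ := Fin (d + 1)) (R := k))
  simp [quadricForm] at hu

instance quadricRing_isLocalRing (k : Type*) [Field k] (d : ℕ) : IsLocalRing (QuadricRing k d) :=
  IsLocalRing.of_surjective' (Ideal.Quotient.mk _) Ideal.Quotient.mk_surjective

end

/-!
Write `D n q` for the dimension of `k[x_1, …, x_n] / (x_1 ^ q, …, x_n ^ q, f)` with
`f = x_1 ^ 2 + ⋯ + x_n ^ 2`. The ring `A_d` of the theorem has dimension `d` and residue field `k`,
and power series may be truncated to polynomials, so its Hilbert--Kunz sequence is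
`D (d + 1) q / q ^ d` for `q = p ^ e` (`hilbertKunzSeq_quadricRing`). The rest is linear algebra in
the finite-dimensional algebra `B n q = k[x] / (x ^ q)`, through the numbers `dim B / (f ^ j)`
(`corank`), whose increments decrease with `j`.

*Convergence.* For `r` a power of `p`, the map `x_i ↦ x_i ^ r` makes `B n (q r)` free of rank
`r ^ n` over `B n q` and sends `f` to `f ^ r`, so `dim B n (q r) / (f ^ (r j))` is `r ^ n` times
`dim B n q / (f ^ j)` (`corank_truncQuadric_pow_mul`). For `j = 1`, concavity in the exponent shows
that `D n q / q ^ (n - 1)` increases along powers of `p`; it is bounded by `2`.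

*Comparison of consecutive dimensions.* For `q = 2 H + 1`, eliminating the last variable `x` by
`x ^ 2 = -f` gives `D (n + 1) q ≤ dim B / (f ^ (H + 1)) + dim B / (f ^ H)`
(`corank_truncQuadric_succ_le`). By concavity the right-hand side is at most `q * D n q`, which is
the weak inequality between the two multiplicities.

*Strictness.* It suffices to save a positive proportion of `q ^ n`. By the scaling property it is
enough to find a single level `q₀ = 2 h + 1` at which `dim B / (f ^ h) < h * D n q₀`, that is, at
which `f` has a Jordan block of size less than `h` (`corank_pow_lt`). Such a block is detected by
`v, w` with `f v = 0`, `f ^ (h - 1) w = 0` and `v w ≠ 0`. With `q₀ = p ^ 2` these are explicit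
(`hasSmallBlock`): two variables carry a block of size one, whose tensor powers settle even `n`,
and three variables carry a block of size `h - 1`, the small summand of the tensor product of a
two-dimensional block in two variables with the odd powers of the third.
-/

noncomputable section

/-! ### Corank of the powers of an element of a finite-dimensional algebra -/

section Corank

variable {k A : Type*} [Field k] [CommRing A] [Algebra k A]

/-- The dimension over `k` of `A / (a)`. -/
def corank (k : Type*) {A : Type*} [Field k] [CommRing A] [Algebra k A] (a : A) : ℕ :=
  Module.finrank k (A ⧸ Ideal.span {a})

lemma corank_add_finrank_range [FiniteDimensional k A] (a : A) :
    corank k a + Module.finrank k (LinearMap.range (LinearMap.mulLeft k a)) =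
      Module.finrank k A := by
  have h : LinearMap.range (LinearMap.mulLeft k a) =
      (Ideal.span {a}).restrictScalars k := by
    ext x
    simp [Ideal.mem_span_singleton', mul_comm]
  rw [h]
  exact Submodule.finrank_quotient_add_finrank ((Ideal.span {a}).restrictScalars k)

lemma corank_le_finrank [FiniteDimensional k A] (a : A) : corank k a ≤ Module.finrank k A :=
  (Nat.le_add_right _ _).trans (corank_add_finrank_range a).le

/-- The increment `dim A/(a ^ (j + 1)) - dim A/(a ^ j)` is the dimension of the part of the
annihilator of `a` that lies in `a ^ j A`. -/
lemma corank_pow_succ [FiniteDimensional k A] (a : A) (j : ℕ) :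
    corank k (a ^ (j + 1)) = corank k (a ^ j) +
      Module.finrank k ↥(LinearMap.range (LinearMap.mulLeft k (a ^ j)) ⊓
        LinearMap.ker (LinearMap.mulLeft k a)) := by
  set W := LinearMap.range (LinearMap.mulLeft k (a ^ j))
  have h1 := corank_add_finrank_range (k := k) (a ^ (j + 1))
  have h2 : corank k (a ^ j) + Module.finrank k W = Module.finrank k A :=
    corank_add_finrank_range (k := k) (a ^ j)
  have h3 := LinearMap.finrank_range_add_finrank_ker ((LinearMap.mulLeft k a).domRestrict W)
  have h4 : LinearMap.range ((LinearMap.mulLeft k a).domRestrict W) =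
      LinearMap.range (LinearMap.mulLeft k (a ^ (j + 1))) := by
    rw [LinearMap.range_domRestrict, pow_succ', LinearMap.mulLeft_mul, LinearMap.range_comp]
  have h5 : Module.finrank k (LinearMap.ker ((LinearMap.mulLeft k a).domRestrict W)) =
      Module.finrank k ↥(W ⊓ LinearMap.ker (LinearMap.mulLeft k a)) := by
    rw [LinearMap.ker_domRestrict, ← Submodule.finrank_map_subtype_eq,
      Submodule.map_comap_subtype]
  rw [h4, h5] at h3
  omega

lemma corank_eq_finrank_ker [FiniteDimensional k A] (a : A) :
    corank k a = Module.finrank k (LinearMap.ker (LinearMap.mulLeft k a)) := by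
  have h1 := corank_add_finrank_range (k := k) a
  have h2 := LinearMap.finrank_range_add_finrank_ker (LinearMap.mulLeft k a)
  omega

lemma corank_pow_succ_le [FiniteDimensional k A] (a : A) (j : ℕ) :
    corank k (a ^ (j + 1)) ≤ corank k (a ^ j) + corank k a := by
  rw [corank_pow_succ, corank_eq_finrank_ker a]
  gcongr
  exact Submodule.finrank_mono inf_le_right

lemma corank_pow_add_le [FiniteDimensional k A] (a : A) (i j : ℕ) :
    corank k (a ^ (i + j)) ≤ corank k (a ^ i) + j * corank k a := by
  induction j with
  | zero => simp
  | succ j ih =>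
    have := corank_pow_succ_le (k := k) a (i + j)
    rw [← add_assoc, add_mul]
    omega

lemma corank_pow_le [FiniteDimensional k A] (a : A) (j : ℕ) :
    corank k (a ^ j) ≤ j * corank k a := by
  have h : corank k (a ^ 0) = 0 := by
    have : Subsingleton (A ⧸ Ideal.span {a ^ 0}) := by
      rw [Ideal.Quotient.subsingleton_iff]; simp
    exact Module.finrank_zero_of_subsingleton
  have := corank_pow_add_le (k := k) a 0 j
  rwa [h, zero_add, zero_add] at this

/-- A pair `v, w` with `a v = 0`, `a ^ s w = 0` and `v w ≠ 0` detects a Jordan block of size at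
most `s` of multiplication by `a`: `v` lies in the annihilator of `a` but not in `a ^ s A`. -/
lemma corank_pow_lt [FiniteDimensional k A] {a v w : A} {s : ℕ} (hv : a * v = 0)
    (hw : a ^ s * w = 0) (hvw : v * w ≠ 0) :
    corank k (a ^ (s + 1)) < (s + 1) * corank k a := by
  have h1 : LinearMap.range (LinearMap.mulLeft k (a ^ s)) ⊓
      LinearMap.ker (LinearMap.mulLeft k a) < LinearMap.ker (LinearMap.mulLeft k a) := by
    refine lt_of_le_of_ne inf_le_right fun h => hvw ?_
    have hv' : v ∈ LinearMap.ker (LinearMap.mulLeft k a) := by simpa using hv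
    rw [← h] at hv'
    obtain ⟨z, rfl⟩ := hv'.1
    simp only [LinearMap.mulLeft_apply]
    rw [mul_right_comm, hw, zero_mul]
  have h2 := Submodule.finrank_lt_finrank_of_lt h1
  rw [← corank_eq_finrank_ker] at h2
  have h3 := corank_pow_le (k := k) a s
  rw [corank_pow_succ, add_mul]
  omega

/-- If `A'` is the direct sum of `Fintype.card ι` translates of the image of `A`, then the corank
of an element of `A` gets multiplied by `Fintype.card ι` in `A'`. Directness of the sum is
encoded as an equality of dimensions. -/
lemma corank_map {A' ι : Type*} [CommRing A'] [Algebra k A'] [Fintype ι]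
    [FiniteDimensional k A] (F : A →ₐ[k] A') (e : ι → A')
    (hspan : ∀ y : A', ∃ b : ι → A, ∑ i, F (b i) * e i = y)
    (hdim : Module.finrank k A' = Fintype.card ι * Module.finrank k A) (a : A) :
    corank k (F a) = Fintype.card ι * corank k a := by
  classical
  let Φ : (ι → A) →ₗ[k] A' :=
    ∑ i, (LinearMap.mulRight k (e i)) ∘ₗ F.toLinearMap ∘ₗ LinearMap.proj i
  have hΦ (b : ι → A) : Φ b = ∑ i, F (b i) * e i := by simp [Φ]
  have hsurj : Function.Surjective Φ := fun y => by
    obtain ⟨b, hb⟩ := hspan y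
    exact ⟨b, (hΦ b).trans hb⟩
  have : FiniteDimensional k A' := Module.Finite.of_surjective Φ hsurj
  have hinj : Function.Injective Φ := by
    refine (LinearMap.injective_iff_surjective_of_finrank_eq_finrank ?_).2 hsurj
    rw [hdim, Module.finrank_pi_fintype]; simp
  let E := LinearEquiv.ofBijective Φ ⟨hinj, hsurj⟩
  have hmap : Submodule.map (E : (ι → A) →ₗ[k] A')
      (Submodule.pi Set.univ fun _ => (Ideal.span {a}).restrictScalars k) =
      (Ideal.span {F a}).restrictScalars k := by
    ext y
    constructor
    · rintro ⟨b, hb, rfl⟩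
      change Φ b ∈ Ideal.span {F a}
      rw [hΦ]
      refine sum_mem fun i _ => Ideal.mul_mem_right _ _ ?_
      have hbi : b i ∈ Ideal.span {a} := hb i trivial
      rw [Ideal.mem_span_singleton] at hbi ⊢
      exact map_dvd F hbi
    · intro hy
      obtain ⟨z, rfl⟩ := Ideal.mem_span_singleton.1 (show y ∈ Ideal.span {F a} from hy)
      obtain ⟨b, rfl⟩ := hsurj z
      refine ⟨fun i => a * b i, fun i _ => ?_, ?_⟩
      · exact Ideal.mul_mem_right _ _ (Ideal.mem_span_singleton_self a)
      · change Φ _ = _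
        simp [hΦ, Finset.mul_sum, mul_assoc]
  have e1 := (Submodule.Quotient.equiv _ _ E hmap).finrank_eq
  have e2 := (Submodule.quotientPi
    (fun _ : ι => (Ideal.span {a}).restrictScalars k)).finrank_eq
  rw [Module.finrank_pi_fintype] at e2
  rw [corank, corank]
  refine (e1.symm.trans e2).trans ?_
  simp
  exact Or.inl rfl

end Corank

/-! ### Truncated polynomial rings -/

section Trunc

variable (k : Type*) [Field k] (n q : ℕ)

/-- The ideal `(x_1 ^ q, …, x_n ^ q)` of `k[x_1, …, x_n]`. -/
def truncIdeal : Ideal (MvPolynomial (Fin n) k) :=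
  Ideal.span (Set.range fun i => MvPolynomial.X i ^ q)

/-- The truncated polynomial ring `k[x_1, …, x_n] / (x_1 ^ q, …, x_n ^ q)`. -/
abbrev TruncRing : Type _ := MvPolynomial (Fin n) k ⧸ truncIdeal k n q

variable {n} in
/-- The class of the `i`-th variable in the truncated polynomial ring. -/
def truncX (i : Fin n) : TruncRing k n q := Ideal.Quotient.mk _ (MvPolynomial.X i)

/-- The class of `x_1 ^ 2 + ⋯ + x_n ^ 2` in the truncated polynomial ring. -/
def truncQuadric : TruncRing k n q := ∑ i, truncX k q i ^ 2

variable {k n q}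

lemma mem_truncIdeal {f : MvPolynomial (Fin n) k} :
    f ∈ truncIdeal k n q ↔ ∀ m, (∀ i, m i < q) → f.coeff m = 0 := by
  have h : truncIdeal k n q = Ideal.span ((fun s => MvPolynomial.monomial s (1 : k)) ''
      Set.range fun i => Finsupp.single i q) := by
    rw [truncIdeal, ← Set.range_comp]
    simp [Function.comp_def, MvPolynomial.X_pow_eq_monomial]
  rw [h, MvPolynomial.mem_ideal_span_monomial_image]
  refine forall_congr' fun m => ?_
  simp only [MvPolynomial.mem_support_iff, Set.mem_range, exists_exists_eq_and,
    Finsupp.single_le_iff]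
  rw [← not_imp_not, not_not]
  simp

lemma truncX_pow (i : Fin n) : truncX k q i ^ q = 0 := by
  rw [truncX, ← map_pow, Ideal.Quotient.eq_zero_iff_mem]
  exact Ideal.subset_span ⟨i, rfl⟩

lemma prod_truncX_pow_ne_zero (hq : 0 < q) : ∏ i : Fin n, truncX k q i ^ (q - 1) ≠ 0 := by
  simp only [truncX, ← map_pow, ← map_prod]
  rw [Ne, Ideal.Quotient.eq_zero_iff_mem, mem_truncIdeal]
  intro h
  have := h (∑ i, Finsupp.single i (q - 1)) fun i => by
    rw [Finsupp.finsetSum_apply]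
    simp only [Finsupp.single_apply, Finset.sum_ite_eq', Finset.mem_univ, if_true]
    omega
  simp only [MvPolynomial.X_pow_eq_monomial] at this
  rw [← MvPolynomial.monomial_sum_one, MvPolynomial.coeff_monomial] at this
  simp at this

/-- The coefficients at the monomials that are not in `(x_1 ^ q, …, x_n ^ q)`. -/
def boxCoeff (k : Type*) [Field k] (n q : ℕ) :
    MvPolynomial (Fin n) k →ₗ[k] ((Fin n → Fin q) → k) :=
  LinearMap.pi fun m => MvPolynomial.lcoeff k (Finsupp.equivFunOnFinite.symm fun i => (m i : ℕ))

lemma ker_boxCoeff : LinearMap.ker (boxCoeff k n q) = (truncIdeal k n q).restrictScalars k := by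
  ext f
  rw [Submodule.restrictScalars_mem, mem_truncIdeal, LinearMap.mem_ker, funext_iff]
  refine ⟨fun h m hm => ?_, fun h m => h _ fun i => (m i).2⟩
  have := h fun i => ⟨m i, hm i⟩
  simpa [boxCoeff] using this

lemma boxCoeff_surjective : Function.Surjective (boxCoeff k n q) := by
  classical
  intro c
  refine ⟨∑ m, MvPolynomial.monomial (Finsupp.equivFunOnFinite.symm fun i => (m i : ℕ)) (c m), ?_⟩
  ext m
  simp only [boxCoeff, LinearMap.pi_apply, MvPolynomial.lcoeff_apply, MvPolynomial.coeff_sum,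
    MvPolynomial.coeff_monomial]
  rw [Finset.sum_eq_single m]
  · simp
  · intro b _ hb
    rw [if_neg]
    intro h
    exact hb (funext fun i => Fin.ext (congrFun (Finsupp.equivFunOnFinite.symm.injective h) i))
  · simp

/-- The monomials with all exponents below `q` are coordinates on the truncated ring. -/
def truncEquiv (k : Type*) [Field k] (n q : ℕ) : TruncRing k n q ≃ₗ[k] ((Fin n → Fin q) → k) :=
  (Submodule.quotEquivOfEq _ _ ker_boxCoeff.symm).trans
    (LinearMap.quotKerEquivOfSurjective _ boxCoeff_surjective)

instance : FiniteDimensional k (TruncRing k n q) :=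
  Module.Finite.equiv (truncEquiv k n q).symm

lemma finrank_truncRing : Module.finrank k (TruncRing k n q) = q ^ n := by
  rw [(truncEquiv k n q).finrank_eq]; simp

/-- A `k`-algebra homomorphism out of the truncated polynomial ring. -/
def truncLift {A : Type*} [CommRing A] [Algebra k A] (y : Fin n → A) (hy : ∀ i, y i ^ q = 0) :
    TruncRing k n q →ₐ[k] A :=
  Ideal.Quotient.liftₐ _ (MvPolynomial.aeval y) fun f hf => by
    have : truncIdeal k n q ≤ RingHom.ker (MvPolynomial.aeval (R := k) y) := by
      rw [truncIdeal, Ideal.span_le]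
      rintro _ ⟨i, rfl⟩
      simp [RingHom.mem_ker, hy]
    exact this hf

@[simp] lemma truncLift_truncX {A : Type*} [CommRing A] [Algebra k A] (y : Fin n → A)
    (hy : ∀ i, y i ^ q = 0) (i : Fin n) : truncLift (k := k) y hy (truncX k q i) = y i := by
  exact MvPolynomial.aeval_X y i

/-- A subspace of the truncated ring that contains the monomials is everything. -/
lemma mem_of_monomials (W : Submodule k (TruncRing k n q))
    (h : ∀ m : Fin n → ℕ, ∏ i, truncX k q i ^ m i ∈ W) (y : TruncRing k n q) : y ∈ W := by
  obtain ⟨f, rfl⟩ := Ideal.Quotient.mk_surjective y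
  induction f using MvPolynomial.induction_on' with
  | monomial m c =>
    have : Ideal.Quotient.mk (truncIdeal k n q) (MvPolynomial.monomial m c) =
        c • ∏ i, truncX k q i ^ m i := by
      rw [MvPolynomial.monomial_eq, ← MvPolynomial.smul_eq_C_mul,
        Finsupp.prod_fintype _ _ (by simp)]
      simp only [truncX, ← map_pow, ← map_prod]
      rfl
    rw [this]
    exact W.smul_mem _ (h _)
  | add f g hf hg => rw [map_add]; exact W.add_mem hf hg

/-- The homomorphism `x_i ↦ x_i ^ r` makes `k[x] / (x ^ (q r))` free of rank `r ^ n` over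
`k[x] / (x ^ q)`, and when `r` is a power of the characteristic it maps the quadric to its `r`-th
power. -/
lemma corank_truncQuadric_pow_mul (p e j : ℕ) [CharP k p] [Fact p.Prime] :
    corank k (truncQuadric k n (q * p ^ e) ^ (p ^ e * j)) =
      (p ^ e) ^ n * corank k (truncQuadric k n q ^ j) := by
  have : ExpChar k p := .prime Fact.out
  set r := p ^ e with hr
  have hr0 : 0 < r := pow_pos (Nat.Prime.pos Fact.out) e
  let F : TruncRing k n q →ₐ[k] TruncRing k n (q * r) :=
    truncLift (fun i => truncX k (q * r) i ^ r) fun i => by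
      rw [← pow_mul, mul_comm r q, truncX_pow]
  have hF : truncQuadric k n (q * r) ^ (r * j) = F (truncQuadric k n q ^ j) := by
    rcases subsingleton_or_nontrivial (TruncRing k n (q * r)) with hs | hs
    · exact Subsingleton.elim _ _
    have : ExpChar (TruncRing k n (q * r)) p :=
      expChar_of_injective_algebraMap (algebraMap k _).injective p
    rw [pow_mul, map_pow, truncQuadric, truncQuadric, map_sum,
      sum_pow_char_pow (R := TruncRing k n (q * r)) p e]
    congr 1
    refine Finset.sum_congr rfl fun i _ => ?_
    rw [map_pow, truncLift_truncX, ← pow_mul, ← pow_mul, mul_comm 2]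
  rw [hF, corank_map (ι := Fin n → Fin r) F
    (fun m => ∏ i, truncX k (q * r) i ^ (m i : ℕ)) ?_ ?_ (truncQuadric k n q ^ j)]
  · simp
  · let W : Submodule k (TruncRing k n (q * r)) := LinearMap.range
      (∑ m : Fin n → Fin r, (LinearMap.mulRight k (∏ i, truncX k (q * r) i ^ (m i : ℕ))) ∘ₗ
        F.toLinearMap ∘ₗ LinearMap.proj m)
    intro y
    suffices hy : y ∈ W by
      obtain ⟨b, hb⟩ := hy
      exact ⟨b, by simpa using hb⟩
    refine mem_of_monomials W (fun m => ?_) y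
    refine ⟨Pi.single (fun i => ⟨m i % r, Nat.mod_lt _ hr0⟩) (∏ i, truncX k q i ^ (m i / r)), ?_⟩
    simp only [LinearMap.sum_apply, LinearMap.comp_apply, LinearMap.proj_apply]
    rw [Finset.sum_eq_single (fun i => ⟨m i % r, Nat.mod_lt _ hr0⟩)]
    · simp only [Pi.single_eq_same, AlgHom.toLinearMap_apply, LinearMap.mulRight_apply, map_prod,
        map_pow, F, truncLift_truncX, ← Finset.prod_mul_distrib, ← pow_mul, ← pow_add,
        Nat.div_add_mod]
    · intro b _ hb
      simp [Pi.single_eq_of_ne hb]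
    · simp
  · rw [finrank_truncRing, finrank_truncRing]
    simp [mul_pow, mul_comm]

/-- The inclusion of `k[x_1, …, x_n] / (x ^ q)` into `k[x_1, …, x_(n + 1)] / (x ^ q)`. -/
def truncIncl (k : Type*) [Field k] (n q : ℕ) : TruncRing k n q →ₐ[k] TruncRing k (n + 1) q :=
  truncLift (fun i => truncX k q i.castSucc) fun _ => truncX_pow _

@[simp] lemma truncIncl_truncX (i : Fin n) :
    truncIncl k n q (truncX k q i) = truncX k q i.castSucc := by
  simp [truncIncl]

lemma truncQuadric_succ : truncQuadric k (n + 1) q =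
    truncIncl k n q (truncQuadric k n q) + truncX k q (Fin.last n) ^ 2 := by
  simp [truncQuadric, Fin.sum_univ_castSucc]

/-- Elimination of a variable `t` with `t ^ 2 = -f` and `t ^ (2 h + 1) = 0`: if every element of
`C` is of the form `b + b' t` with `b, b'` from `B`, then `b` matters only modulo `f ^ (h + 1)` and
`b'` only modulo `f ^ h`. -/
lemma finrank_le_corank_add_corank {B C : Type*} [CommRing B] [CommRing C] [Algebra k B]
    [Algebra k C] [FiniteDimensional k B] (φ : B →ₐ[k] C) {f : B} {t : C} {h : ℕ}
    (ht : t ^ (2 * h + 1) = 0) (hf : φ f = -t ^ 2) (hgen : ∀ y, ∃ b b', φ b + φ b' * t = y) :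
    Module.finrank k C ≤ corank k (f ^ (h + 1)) + corank k (f ^ h) := by
  have hf1 : φ (f ^ (h + 1)) = 0 := by
    rw [map_pow, hf, neg_pow, ← pow_mul, show 2 * (h + 1) = 2 * h + 1 + 1 by omega,
      pow_succ t, ht]
    simp
  have hf2 : φ (f ^ h) * t = 0 := by
    rw [map_pow, hf, neg_pow, ← pow_mul, mul_assoc, ← pow_succ, ht, mul_zero]
  let g₁ : (B ⧸ Ideal.span {f ^ (h + 1)}) →ₗ[k] C :=
    Submodule.liftQ ((Ideal.span {f ^ (h + 1)}).restrictScalars k) φ.toLinearMap fun y hy => by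
      obtain ⟨z, rfl⟩ := Ideal.mem_span_singleton.1
        (show y ∈ Ideal.span {f ^ (h + 1)} from hy)
      simp only [LinearMap.mem_ker, AlgHom.toLinearMap_apply]
      rw [map_mul, hf1, zero_mul]
  let g₂ : (B ⧸ Ideal.span {f ^ h}) →ₗ[k] C :=
    Submodule.liftQ ((Ideal.span {f ^ h}).restrictScalars k)
      (LinearMap.mulRight k t ∘ₗ φ.toLinearMap) fun y hy => by
      obtain ⟨z, rfl⟩ := Ideal.mem_span_singleton.1 (show y ∈ Ideal.span {f ^ h} from hy)
      simp only [LinearMap.mem_ker, LinearMap.comp_apply, AlgHom.toLinearMap_apply,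
        LinearMap.mulRight_apply]
      rw [map_mul, mul_right_comm, hf2, zero_mul]
  have hg : Function.Surjective (LinearMap.coprod g₁ g₂) := by
    intro y
    obtain ⟨b, b', hb⟩ := hgen y
    exact ⟨(Ideal.Quotient.mk _ b, Ideal.Quotient.mk _ b'), hb⟩
  have : Module.Finite k (B ⧸ Ideal.span {f ^ (h + 1)}) :=
    Module.Finite.of_surjective (Ideal.Quotient.mkₐ k _).toLinearMap Ideal.Quotient.mk_surjective
  have : Module.Finite k (B ⧸ Ideal.span {f ^ h}) :=
    Module.Finite.of_surjective (Ideal.Quotient.mkₐ k _).toLinearMap Ideal.Quotient.mk_surjective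
  have := LinearMap.finrank_le_finrank_of_surjective hg
  rwa [Module.finrank_prod] at this

lemma map_truncX_last_sq {C : Type*} [CommRing C] [Algebra k C]
    (π : TruncRing k (n + 1) q →ₐ[k] C) (hπ : π (truncQuadric k (n + 1) q) = 0) :
    π (truncX k q (Fin.last n)) ^ 2 = - π (truncIncl k n q (truncQuadric k n q)) := by
  rw [truncQuadric_succ, map_add, map_pow] at hπ
  linear_combination hπ

/-- Modulo the quadric in `n + 1` variables, every element of the truncated ring is `b + b' x`
with `x` the last variable and `b, b'` in the first `n` variables. -/
lemma exists_incl_add_incl_mul {C : Type*} [CommRing C] [Algebra k C]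
    (π : TruncRing k (n + 1) q →ₐ[k] C) (hπ : π (truncQuadric k (n + 1) q) = 0)
    (y : TruncRing k (n + 1) q) :
    ∃ b b', π (truncIncl k n q b) + π (truncIncl k n q b') * π (truncX k q (Fin.last n)) =
      π y := by
  have hf := map_truncX_last_sq π hπ
  obtain ⟨y, rfl⟩ := Ideal.Quotient.mk_surjective y
  induction y using MvPolynomial.induction_on with
  | C a =>
    refine ⟨algebraMap k _ a, 0, ?_⟩
    rw [AlgHom.commutes, map_zero, map_zero, zero_mul, add_zero]
    rfl
  | add y₁ y₂ h₁ h₂ =>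
    obtain ⟨b, b', hb⟩ := h₁
    obtain ⟨c, c', hc⟩ := h₂
    refine ⟨b + c, b' + c', ?_⟩
    simp only [map_add, ← hb, ← hc]
    ring
  | mul_X y i hy =>
    obtain ⟨b, b', hb⟩ := hy
    rw [map_mul, map_mul, ← hb]
    change ∃ c c', _ = _ * π (truncX k q i)
    refine Fin.lastCases ?_ (fun i => ?_) i
    · refine ⟨- (b' * truncQuadric k n q), b, ?_⟩
      simp only [map_neg, map_mul]
      linear_combination -π (truncIncl k n q b') * hf
    · refine ⟨b * truncX k q i, b' * truncX k q i, ?_⟩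
      simp only [map_mul, truncIncl_truncX]
      ring

lemma finrank_le_of_truncQuadric_eq_zero {C : Type*} [CommRing C] [Algebra k C] (h : ℕ)
    (π : TruncRing k (n + 1) (2 * h + 1) →ₐ[k] C) (hsurj : Function.Surjective π)
    (hπ : π (truncQuadric k (n + 1) (2 * h + 1)) = 0) :
    Module.finrank k C ≤ corank k (truncQuadric k n (2 * h + 1) ^ (h + 1)) +
        corank k (truncQuadric k n (2 * h + 1) ^ h) := by
  refine finrank_le_corank_add_corank (π.comp (truncIncl k n (2 * h + 1)))
    (t := π (truncX k (2 * h + 1) (Fin.last n))) ?_ ?_ fun y => ?_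
  · rw [← map_pow, truncX_pow, map_zero]
  · exact (neg_eq_iff_eq_neg.2 (map_truncX_last_sq π hπ)).symm
  · obtain ⟨y, rfl⟩ := hsurj y
    exact exists_incl_add_incl_mul π hπ y

/-- The Hilbert--Kunz function in `n + 1` variables is bounded by the coranks of the powers of
the quadric in `n` variables. -/
lemma corank_truncQuadric_succ_le (h : ℕ) :
    corank k (truncQuadric k (n + 1) (2 * h + 1)) ≤
      corank k (truncQuadric k n (2 * h + 1) ^ (h + 1)) +
        corank k (truncQuadric k n (2 * h + 1) ^ h) :=
  finrank_le_of_truncQuadric_eq_zero h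
    (Ideal.Quotient.mkₐ k (Ideal.span {truncQuadric k (n + 1) (2 * h + 1)}))
    Ideal.Quotient.mk_surjective
    (Ideal.Quotient.eq_zero_iff_mem.2 (Ideal.mem_span_singleton_self _))

lemma corank_truncQuadric_succ_le_two_mul (h : ℕ) :
    corank k (truncQuadric k (n + 1) (2 * h + 1)) ≤ 2 * (2 * h + 1) ^ n := by
  have h1 := corank_truncQuadric_succ_le (k := k) (n := n) h
  have h2 := corank_le_finrank (k := k) (truncQuadric k n (2 * h + 1) ^ (h + 1))
  have h3 := corank_le_finrank (k := k) (truncQuadric k n (2 * h + 1) ^ h)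
  rw [finrank_truncRing] at h2 h3
  omega

end Trunc

/-! ### Small Jordan blocks of the quadric -/

section Witness

open Finset

variable {E : Type*} [CommRing E]

lemma pow_mul_eq_of_mul_eq {a b v : E} (h : b * v = a * v) (j : ℕ) : b ^ j * v = a ^ j * v := by
  induction j with
  | zero => simp
  | succ j ih => rw [pow_succ', mul_assoc, ih, pow_succ, mul_assoc, ← h]; ring

lemma sum_range_mul_eq_of_mul_eq {a b v : E} (h : b * v = a * v) (c : ℕ → E) (n : ℕ) :
    (∑ i ∈ range n, c i * (a ^ i * b ^ (n - 1 - i))) * v =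
      (∑ i ∈ range n, c i) * a ^ (n - 1) * v := by
  simp only [sum_mul]
  refine sum_congr rfl fun i hi => ?_
  have hi' : i + (n - 1 - i) = n - 1 := by have := mem_range.1 hi; omega
  rw [mul_assoc, mul_assoc, pow_mul_eq_of_mul_eq h, ← mul_assoc (a ^ i), ← pow_add, hi', mul_assoc]

lemma pow_mul_geomSum {a b : E} {n : ℕ} (hn : 0 < n) (ha : a ^ (n + 1) = 0) :
    a ^ n * ∑ i ∈ range n, a ^ i * b ^ (n - 1 - i) = a ^ n * b ^ (n - 1) := by
  rw [mul_sum, sum_eq_single 0]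
  · simp
  · intro i _ hi
    obtain ⟨j, rfl⟩ := Nat.exists_eq_succ_of_ne_zero hi
    rw [← mul_assoc, ← pow_add, show n + j.succ = n + 1 + j by omega, pow_add, ha]
    simp
  · simp [hn.ne']

/-- The weighted sum `∑ (i + 1) a ^ i b ^ (n - 1 - i)` is a preimage under multiplication by
`b - a` of the geometric sum `∑ a ^ i b ^ (n - i)`, up to a multiple of `a ^ n`. -/
lemma weightedGeomSum_mul_sub (a b : E) (n : ℕ) :
    (b - a) * ∑ i ∈ range n, ((i : E) + 1) * (a ^ i * b ^ (n - 1 - i)) =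
      b * (∑ i ∈ range n, a ^ i * b ^ (n - 1 - i)) - n * a ^ n := by
  induction n with
  | zero => simp
  | succ n ih =>
    have h1 : ∑ i ∈ range (n + 1), ((i : E) + 1) * (a ^ i * b ^ (n + 1 - 1 - i)) =
        b * (∑ i ∈ range n, ((i : E) + 1) * (a ^ i * b ^ (n - 1 - i))) + (n + 1) * a ^ n := by
      rw [sum_range_succ, mul_sum]
      congr 1
      · refine sum_congr rfl fun i hi => ?_
        rw [show n + 1 - 1 - i = (n - 1 - i) + 1 by have := mem_range.1 hi; omega, pow_succ]
        ring
      · simp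
    have h2 : ∑ i ∈ range (n + 1), a ^ i * b ^ (n + 1 - 1 - i) =
        b * (∑ i ∈ range n, a ^ i * b ^ (n - 1 - i)) + a ^ n := by
      rw [sum_range_succ, mul_sum]
      congr 1
      · refine sum_congr rfl fun i hi => ?_
        rw [show n + 1 - 1 - i = (n - 1 - i) + 1 by have := mem_range.1 hi; omega, pow_succ]
        ring
      · simp
    rw [h1, h2]
    push_cast
    linear_combination b * ih

/-- A one-dimensional Jordan block of `x ^ 2 + y ^ 2` on `k[x, y] / (x ^ (2 h + 1), y ^ (2 h + 1))`:
the element `v` is `x y` times the geometric sum in `-x ^ 2` and `y ^ 2`. -/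
lemma exists_binary_witness {x y : E} {h : ℕ} (hh : 0 < h) (hx : x ^ (2 * h + 1) = 0)
    (hy : y ^ (2 * h + 1) = 0) :
    ∃ v, (x ^ 2 + y ^ 2) * v = 0 ∧
      v * v = (-1) ^ (h + 1) * h * (x ^ (2 * h) * y ^ (2 * h)) := by
  obtain ⟨a, ha⟩ : ∃ a, a = - x ^ 2 := ⟨_, rfl⟩
  obtain ⟨b, hb⟩ : ∃ b, b = y ^ 2 := ⟨_, rfl⟩
  have hah : a ^ h = (-1) ^ h * x ^ (2 * h) := by rw [ha, neg_pow, ← pow_mul]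
  have hbh : b ^ h = y ^ (2 * h) := by rw [hb, ← pow_mul]
  have ha1 : a ^ (h + 1) = 0 := by
    rw [ha, neg_pow, ← pow_mul, show 2 * (h + 1) = 2 * h + 1 + 1 by omega, pow_succ x, hx]
    simp
  set G := ∑ i ∈ range h, a ^ i * b ^ (h - 1 - i) with hG
  have hGab : G * (a - b) = a ^ h - b ^ h := geom_sum₂_mul a b h
  have hxa : x * a ^ h = 0 := by
    rw [hah, mul_left_comm, ← pow_succ', hx, mul_zero]
  have hyb : y * b ^ h = 0 := by rw [hbh, ← pow_succ', hy]
  have hv : (b - a) * (x * y * G) = 0 := by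
    linear_combination -(x * y) * hGab - y * hxa + x * hyb
  refine ⟨x * y * G, ?_, ?_⟩
  · rw [← hv, ha, hb]; ring
  · have h1 := sum_range_mul_eq_of_mul_eq (a := a) (b := b) (v := x * y * G)
      (by linear_combination hv) (fun _ => 1) h
    simp only [one_mul, sum_const, card_range, nsmul_eq_mul, mul_one] at h1
    have h2 := pow_mul_geomSum (b := b) hh ha1
    rw [← hG] at h1 h2
    have h3 : a ^ h = a ^ (h - 1) * a := by rw [← pow_succ, Nat.sub_add_cancel hh]
    have h4 : b ^ h = b ^ (h - 1) * b := by rw [← pow_succ, Nat.sub_add_cancel hh]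
    calc x * y * G * (x * y * G) = x * y * (h * a ^ (h - 1) * (x * y * G)) := by
          rw [← h1]; ring
      _ = - h * b * (a ^ h * G) := by rw [h3, ha, hb]; ring
      _ = - h * (a ^ h * b ^ h) := by rw [h2, h4]; ring
      _ = _ := by rw [hah, hbh]; ring

/-- A two-dimensional Jordan block `u, v` of `x ^ 2 + y ^ 2`. -/
lemma exists_binary_witness_two {x y : E} {h : ℕ} (hh : 0 < h) (hx : x ^ (2 * h + 1) = 0)
    (hy : y ^ (2 * h + 1) = 0) :
    ∃ u v, (x ^ 2 + y ^ 2) * u = v ∧ (x ^ 2 + y ^ 2) * v = 0 ∧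
      u * v = (-1) ^ (h + 1) * (∑ i ∈ range h, ((i : E) + 1)) * (x ^ (2 * h) * y ^ (2 * h)) := by
  obtain ⟨a, ha⟩ : ∃ a, a = - x ^ 2 := ⟨_, rfl⟩
  obtain ⟨b, hb⟩ : ∃ b, b = y ^ 2 := ⟨_, rfl⟩
  have hah : a ^ h = (-1) ^ h * x ^ (2 * h) := by rw [ha, neg_pow, ← pow_mul]
  have hbh : b ^ h = y ^ (2 * h) := by rw [hb, ← pow_mul]
  have ha1 : a ^ (h + 1) = 0 := by
    rw [ha, neg_pow, ← pow_mul, show 2 * (h + 1) = 2 * h + 1 + 1 by omega, pow_succ x, hx]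
    simp
  set G := ∑ i ∈ range h, a ^ i * b ^ (h - 1 - i) with hG
  set U := ∑ i ∈ range h, ((i : E) + 1) * (a ^ i * b ^ (h - 1 - i)) with hU
  have hGab : G * (a - b) = a ^ h - b ^ h := geom_sum₂_mul a b h
  have hUab : (b - a) * U = b * G - h * a ^ h := weightedGeomSum_mul_sub a b h
  have hxa : x * a ^ h = 0 := by
    rw [hah, mul_left_comm, ← pow_succ', hx, mul_zero]
  have hyb : b * b ^ h = 0 := by rw [hbh, hb, pow_two, mul_assoc, ← pow_succ', hy, mul_zero]
  have hv : (b - a) * (x * b * G) = 0 := by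
    linear_combination -(x * b) * hGab - b * hxa + x * hyb
  have hT : x ^ 2 + y ^ 2 = b - a := by rw [ha, hb]; ring
  rw [hT]
  refine ⟨x * U, x * b * G, ?_, hv, ?_⟩
  · linear_combination x * hUab - h * hxa
  · have h1 := sum_range_mul_eq_of_mul_eq (a := a) (b := b) (v := x * b * G)
      (by linear_combination hv) (fun i => (i : E) + 1) h
    have h2 := pow_mul_geomSum (b := b) hh ha1
    rw [← hG] at h2
    rw [← hU] at h1
    have h3 : a ^ h = a ^ (h - 1) * a := by rw [← pow_succ, Nat.sub_add_cancel hh]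
    have h4 : b ^ h = b ^ (h - 1) * b := by rw [← pow_succ, Nat.sub_add_cancel hh]
    set c := ∑ i ∈ range h, ((i : E) + 1)
    calc x * U * (x * b * G) = x * (c * a ^ (h - 1) * (x * b * G)) := by
          rw [← h1]; ring
      _ = - c * b * (a ^ h * G) := by rw [h3, ha]; ring
      _ = - c * (a ^ h * b ^ h) := by rw [h2, h4]; ring
      _ = _ := by rw [hah, hbh]; ring

/-- The summand of size `h - 1` of the tensor product of the two-dimensional block `u, v` with the
block `z, z ^ 3, …, z ^ (2 h - 1)`; here `h = m + 2`. -/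
lemma exists_ternary_witness {x y z : E} {m : ℕ} (hx : x ^ (2 * (m + 2) + 1) = 0)
    (hy : y ^ (2 * (m + 2) + 1) = 0) (hz : z ^ (2 * (m + 2) + 1) = 0) :
    ∃ v w, (x ^ 2 + y ^ 2 + z ^ 2) * v = 0 ∧ (x ^ 2 + y ^ 2 + z ^ 2) ^ (m + 1) * w = 0 ∧
      v * w = (-1) ^ m * (m + 2) * (∑ i ∈ range (m + 2), ((i : E) + 1)) *
        (x ^ (2 * (m + 2)) * y ^ (2 * (m + 2)) * z ^ (2 * (m + 2))) := by
  obtain ⟨u, v, hu, hv, huv⟩ := exists_binary_witness_two (by omega) hx hy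
  set T := x ^ 2 + y ^ 2
  obtain ⟨t, ht⟩ : ∃ t, t = z ^ 2 := ⟨_, rfl⟩
  have hzt : z * t ^ (m + 2) = 0 := by rw [ht, ← pow_mul, ← pow_succ', hz]
  have hvv : v * v = 0 := by
    calc v * v = u * (T * v) := by rw [← hu]; ring
      _ = 0 := by rw [hv, mul_zero]
  have hpv (j : ℕ) : (T + t) ^ j * v = t ^ j * v := by
    refine pow_mul_eq_of_mul_eq ?_ j
    linear_combination hv
  have hpu (j : ℕ) : (T + t) ^ (j + 1) * u = t ^ (j + 1) * u + (j + 1) * t ^ j * v := by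
    induction j with
    | zero => simp; linear_combination hu
    | succ j ih =>
      rw [pow_succ', mul_assoc, ih]
      push_cast
      linear_combination t ^ (j + 1) * hu + (j + 1) * t ^ j * hv
  rw [← ht]
  refine ⟨z * (u * t ^ (m + 1) - v * t ^ m), z * (u * t - (m + 1) * v), ?_, ?_, ?_⟩
  · linear_combination z * t ^ (m + 1) * hu - z * t ^ m * hv + u * hzt
  · linear_combination z * t * hpu m - z * (m + 1) * hpv (m + 1) + u * hzt
  · have hzz : z ^ (2 * (m + 2)) = t * t ^ (m + 1) := by rw [ht, pow_mul]; ring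
    rw [hzz]
    have hz2 : z ^ 2 * t ^ (m + 2) = 0 := by rw [pow_two, mul_assoc, hzt, mul_zero]
    calc _ = u ^ 2 * (z ^ 2 * t ^ (m + 2)) - (m + 2) * (u * v) * (z ^ 2 * t ^ (m + 1)) +
          (m + 1) * z ^ 2 * t ^ m * (v * v) := by ring
      _ = _ := by rw [hz2, hvv, huv, ← ht]; ring

variable (k : Type*) [Field k]

/-- There are `v, w` with `f v = 0` and `f ^ (h - 1) w = 0` whose product spans the socle of
`k[x_1, …, x_n] / (x ^ (2 h + 1))`, where `f` is the quadric. By duality this says that `f` has a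
Jordan block of size less than `h`. -/
def HasSmallBlock (n h : ℕ) : Prop :=
  ∃ v w : TruncRing k n (2 * h + 1), truncQuadric k n (2 * h + 1) * v = 0 ∧
    truncQuadric k n (2 * h + 1) ^ (h - 1) * w = 0 ∧
    ∃ c : k, c ≠ 0 ∧ v * w = algebraMap k _ c * ∏ i, truncX k (2 * h + 1) i ^ (2 * h)

variable {k}

lemma hasSmallBlock_zero {h : ℕ} (hh : 2 ≤ h) : HasSmallBlock k 0 h := by
  refine ⟨1, 1, ?_, ?_, 1, one_ne_zero, ?_⟩
  · simp [truncQuadric]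
  · simp [truncQuadric, zero_pow (show h - 1 ≠ 0 by omega)]
  · simp

lemma hasSmallBlock_three {h : ℕ} (hh : 2 ≤ h) (hk : ((2 * h + 1 : ℕ) : k) = 0) :
    HasSmallBlock k 3 h := by
  obtain ⟨m, rfl⟩ := Nat.exists_eq_add_of_le' hh
  obtain ⟨v, w, hv, hw, hvw⟩ := exists_ternary_witness (m := m)
    (truncX_pow (k := k) (q := 2 * (m + 2) + 1) (0 : Fin 3)) (truncX_pow 1) (truncX_pow 2)
  have hQ : truncQuadric k 3 (2 * (m + 2) + 1) =
      truncX k _ 0 ^ 2 + truncX k _ 1 ^ 2 + truncX k _ 2 ^ 2 := by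
    rw [truncQuadric, Fin.sum_univ_three]
  refine ⟨v, w, by rw [hQ, hv], by rw [hQ]; exact hw,
    (-1) ^ m * (m + 2) * (∑ i ∈ range (m + 2), ((i : k) + 1)), ?_, ?_⟩
  · have h1 : 2 * (∑ i ∈ range (m + 2), ((i : k) + 1)) = (m + 2) * (m + 3) := by
      have : ∀ l : ℕ, 2 * (∑ i ∈ range l, ((i : k) + 1)) = l * (l + 1) := fun l => by
        induction l with
        | zero => simp
        | succ l ih => rw [sum_range_succ, mul_add, ih]; push_cast; ring
      rw [this]; push_cast; ring
    push_cast at hk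
    intro h0
    rw [mul_assoc, mul_eq_zero, mul_eq_zero] at h0
    -- Modulo `2 h + 1` the elements `2 h` and `8 * (1 + ⋯ + h) = (2 h) (2 h + 2)` are both `-1`.
    refine one_ne_zero (α := k) ?_
    rcases h0 with h0 | h0 | h0
    · exact absurd h0 (by simp)
    · linear_combination hk - 2 * h0
    · linear_combination (2 * (m + 2) + 1) * hk - 8 * h0 + 4 * h1
  · rw [hvw, Fin.prod_univ_three]
    simp only [map_mul, map_pow, map_neg, map_one, map_add, map_natCast, map_sum, map_ofNat]

/-- Adding two variables tensors with a one-dimensional block, which keeps block sizes. -/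
lemma HasSmallBlock.add_two {n h : ℕ} (hh : 0 < h) (hk : ((2 * h + 1 : ℕ) : k) = 0)
    (H : HasSmallBlock k n h) : HasSmallBlock k (n + 2) h := by
  obtain ⟨v, w, hv, hw, c, hc, hvw⟩ := H
  obtain ⟨s, hs, hss⟩ := exists_binary_witness hh
    (truncX_pow (k := k) (q := 2 * h + 1) (Fin.last n).castSucc) (truncX_pow (Fin.last (n + 1)))
  let φ : TruncRing k n (2 * h + 1) →ₐ[k] TruncRing k (n + 2) (2 * h + 1) :=
    (truncIncl k (n + 1) (2 * h + 1)).comp (truncIncl k n (2 * h + 1))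
  have hφX (i : Fin n) : φ (truncX k (2 * h + 1) i) = truncX k (2 * h + 1) i.castSucc.castSucc := by
    simp [φ]
  have hQ : truncQuadric k (n + 2) (2 * h + 1) = φ (truncQuadric k n (2 * h + 1)) +
      (truncX k (2 * h + 1) (Fin.last n).castSucc ^ 2 +
        truncX k (2 * h + 1) (Fin.last (n + 1)) ^ 2) := by
    rw [truncQuadric_succ, truncQuadric_succ, map_add, map_pow, truncIncl_truncX, add_assoc]
    rfl
  have hpow (j : ℕ) : truncQuadric k (n + 2) (2 * h + 1) ^ j * s =
      φ (truncQuadric k n (2 * h + 1)) ^ j * s := by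
    refine pow_mul_eq_of_mul_eq ?_ j
    rw [hQ, add_mul, hs, add_zero]
  refine ⟨φ v * s, φ w * s, ?_, ?_, c * ((-1) ^ (h + 1) * h), ?_, ?_⟩
  · have := hpow 1
    rw [pow_one, pow_one] at this
    rw [mul_left_comm, this, mul_left_comm, ← mul_assoc, ← map_mul, hv, map_zero, zero_mul]
  · rw [mul_left_comm, hpow, mul_left_comm, ← mul_assoc, ← map_pow, ← map_mul, hw, map_zero,
      zero_mul]
  · refine mul_ne_zero hc (mul_ne_zero (by simp) fun h0 => one_ne_zero (α := k) ?_)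
    push_cast at hk
    linear_combination hk - 2 * h0
  · rw [mul_mul_mul_comm, ← map_mul, hvw, hss, Fin.prod_univ_castSucc, Fin.prod_univ_castSucc,
      map_mul, AlgHom.commutes, map_prod]
    simp only [map_pow, hφX, map_mul, map_neg, map_one, map_natCast]
    ring

/-- For `n = 1` the statement fails: the block sizes of `x ^ 2` are `h` and `h + 1`. -/
lemma hasSmallBlock {n h : ℕ} (hn : n ≠ 1) (hh : 2 ≤ h) (hk : ((2 * h + 1 : ℕ) : k) = 0) :
    HasSmallBlock k n h := by
  induction n using Nat.strong_induction_on with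
  | _ n ih =>
    rcases n with - | - | - | - | n
    · exact hasSmallBlock_zero hh
    · exact absurd rfl hn
    · exact (hasSmallBlock_zero hh).add_two (by omega) hk
    · exact hasSmallBlock_three hh hk
    · exact (ih (n + 2) (by omega) (by omega)).add_two (by omega) hk

lemma corank_truncQuadric_pow_lt {n h : ℕ} (hn : n ≠ 1) (hh : 2 ≤ h)
    (hk : ((2 * h + 1 : ℕ) : k) = 0) :
    corank k (truncQuadric k n (2 * h + 1) ^ h) < h * corank k (truncQuadric k n (2 * h + 1)) := by
  obtain ⟨v, w, hv, hw, c, hc, hvw⟩ := hasSmallBlock hn hh hk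
  obtain ⟨s, rfl⟩ : ∃ s, h = s + 1 := ⟨h - 1, by omega⟩
  refine corank_pow_lt hv hw ?_
  rw [hvw, ← Algebra.smul_def]
  exact smul_ne_zero hc (prod_truncX_pow_ne_zero (q := 2 * (s + 1) + 1) (by omega))

end Witness

/-! ### Truncation of power series -/

section PowerSeries

variable {k : Type*} [Field k] {n q : ℕ}

/-- The ideal `(x_1 ^ q, …, x_n ^ q)` of `k[[x_1, …, x_n]]`. -/
def truncIdealPS (k : Type*) [Field k] (n q : ℕ) : Ideal (MvPowerSeries (Fin n) k) :=
  Ideal.span (Set.range fun i => MvPowerSeries.X i ^ q)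

lemma mem_span_X_pow_of_coeff_eq_zero (s : Finset (Fin n)) (f : MvPowerSeries (Fin n) k)
    (hf : ∀ m : Fin n →₀ ℕ, (∀ i ∈ s, m i < q) → MvPowerSeries.coeff m f = 0) :
    f ∈ truncIdealPS k n q := by
  induction s using Finset.induction_on generalizing f with
  | empty =>
    have : f = 0 := MvPowerSeries.ext fun m => by simpa using hf m (by simp)
    rw [this]
    exact zero_mem _
  | insert a s _ ih =>
    -- Split off the part of `f` that is divisible by `x_a ^ q`.
    let g : MvPowerSeries (Fin n) k := fun m => if m a < q then MvPowerSeries.coeff m f else 0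
    have hg (m : Fin n →₀ ℕ) : MvPowerSeries.coeff m g =
      if m a < q then MvPowerSeries.coeff m f else 0 := rfl
    rw [← sub_add_cancel f g]
    refine add_mem ?_ (ih g fun m hm => ?_)
    · obtain ⟨c, hc⟩ : (MvPowerSeries.X a : MvPowerSeries (Fin n) k) ^ q ∣ f - g := by
        rw [MvPowerSeries.X_pow_dvd_iff]
        intro m hm
        rw [map_sub, hg, if_pos hm, sub_self]
      rw [hc]
      exact Ideal.mul_mem_right _ _ (Ideal.subset_span ⟨a, rfl⟩)
    · rw [hg]
      split_ifs with h
      · exact hf m fun i hi => (Finset.mem_insert.1 hi).elim (fun e => e ▸ h) (hm i)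
      · rfl

lemma mem_truncIdealPS {f : MvPowerSeries (Fin n) k} :
    f ∈ truncIdealPS k n q ↔
      ∀ m : Fin n →₀ ℕ, (∀ i, m i < q) → MvPowerSeries.coeff m f = 0 := by
  classical
  refine ⟨fun hf => ?_, fun hf => mem_span_X_pow_of_coeff_eq_zero Finset.univ f fun m hm =>
    hf m fun i => hm i (Finset.mem_univ i)⟩
  induction hf using Submodule.span_induction with
  | mem x hx =>
    obtain ⟨i, rfl⟩ := hx
    exact fun m hm => MvPowerSeries.X_pow_dvd_iff.1 dvd_rfl m (hm i)
  | zero => simp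
  | add x y _ _ hx hy => intro m hm; rw [map_add, hx m hm, hy m hm, add_zero]
  | smul a x _ hx =>
    intro m hm
    rw [smul_eq_mul, MvPowerSeries.coeff_mul]
    refine Finset.sum_eq_zero fun y hy => ?_
    rw [hx y.2 fun i => lt_of_le_of_lt ?_ (hm i), mul_zero]
    rw [← Finset.HasAntidiagonal.mem_antidiagonal.1 hy]
    simp

lemma coe_mem_truncIdealPS {f : MvPolynomial (Fin n) k} :
    (f : MvPowerSeries (Fin n) k) ∈ truncIdealPS k n q ↔ f ∈ truncIdeal k n q := by
  simp [mem_truncIdealPS, mem_truncIdeal]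

lemma exists_sub_coe_mem_truncIdealPS (q : ℕ) (f : MvPowerSeries (Fin n) k) :
    ∃ g : MvPolynomial (Fin n) k, f - g ∈ truncIdealPS k n q := by
  obtain ⟨g, hg⟩ := boxCoeff_surjective (k := k) (n := n) (q := q)
    fun m => MvPowerSeries.coeff (Finsupp.equivFunOnFinite.symm fun i => (m i : ℕ)) f
  refine ⟨g, mem_truncIdealPS.2 fun m hm => ?_⟩
  have := congrFun hg fun i => ⟨m i, hm i⟩
  simp only [boxCoeff, LinearMap.pi_apply, MvPolynomial.lcoeff_apply] at this
  rw [map_sub, MvPolynomial.coeff_coe, sub_eq_zero]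
  have hm' : (Finsupp.equivFunOnFinite.symm fun i => m i) = m := by ext; simp
  rw [hm'] at this
  exact this.symm

lemma maximalIdeal_mvPowerSeries :
    IsLocalRing.maximalIdeal (MvPowerSeries (Fin n) k) = Ideal.span (Set.range MvPowerSeries.X) := by
  have h1 : Ideal.span (Set.range MvPowerSeries.X) = truncIdealPS k n 1 := by simp [truncIdealPS]
  ext f
  rw [h1, mem_truncIdealPS, IsLocalRing.mem_maximalIdeal, mem_nonunits_iff,
    MvPowerSeries.isUnit_iff_constantCoeff, isUnit_iff_ne_zero, not_not]
  refine ⟨fun h m hm => ?_, fun h => by simpa using h 0 (by simp)⟩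
  have : m = 0 := by ext i; simpa using hm i
  rw [this]; simpa using h

/-! ### The dimension of the quadric ring -/

lemma ringKrullDim_mvPowerSeries (k : Type*) [Field k] (n : ℕ) :
    ringKrullDim (MvPowerSeries (Fin n) k) = n := by
  refine le_antisymm ?_ ?_
  · refine (ringKrullDim_le_spanFinrank_maximalIdeal _).trans ?_
    rw [maximalIdeal_mvPowerSeries]
    have h := Submodule.spanFinrank_span_le_ncard_of_finite (R := MvPowerSeries (Fin n) k)
      (Set.finite_range (MvPowerSeries.X : Fin n → MvPowerSeries (Fin n) k))
    have h2 : (Set.range (MvPowerSeries.X : Fin n → MvPowerSeries (Fin n) k)).ncard ≤ n := by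
      rw [← Set.image_univ]
      refine (Set.ncard_image_le Set.finite_univ).trans ?_
      simp
    exact_mod_cast h.trans h2
  · induction n with
    | zero => exact ringKrullDim_nonneg_of_nontrivial
    | succ n ih =>
      rw [ringKrullDim_eq_of_ringEquiv (MvPowerSeries.finSuccEquiv k n).toRingEquiv]
      refine le_trans ?_ ringKrullDim_succ_le_ringKrullDim_powerseries
      push_cast
      gcongr

lemma krullDimNat_quadricRing (k : Type*) [Field k] (d : ℕ) :
    krullDimNat (QuadricRing k d) = d := by
  have hne : quadricForm k d ≠ 0 := by
    classical
    intro h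
    have := congrArg (MvPowerSeries.coeff (Finsupp.single 0 2)) h
    simp [quadricForm, MvPowerSeries.coeff_X_pow, Finsupp.single_left_inj] at this
  have hmem : quadricForm k d ∈ IsLocalRing.maximalIdeal (MvPowerSeries (Fin (d + 1)) k) := by
    rw [maximalIdeal_mvPowerSeries]
    exact sum_mem fun i _ =>
      Ideal.pow_mem_of_mem _ (Ideal.subset_span (Set.mem_range_self i)) 2 two_pos
  have h := ringKrullDim_quotient_span_singleton_succ_eq_ringKrullDim_of_mem_nonZeroDivisors
    (mem_nonZeroDivisors_of_ne_zero hne) hmem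
  rw [ringKrullDim_mvPowerSeries] at h
  have h' : ringKrullDim (QuadricRing k d) = d := by
    have : ((d + 1 : ℕ) : WithBot ℕ∞) = (d : WithBot ℕ∞) + 1 := by push_cast; rfl
    rw [this] at h
    exact ENat.WithBot.add_one_cancel.1 h
  rw [krullDimNat, h']
  rfl

/-! ### The Hilbert--Kunz function as a corank -/

/-- The length over a local `k`-algebra with residue field `k` is the dimension over `k`. -/
lemma length_toNat_eq_finrank {R M : Type*} [CommRing R] [IsLocalRing R] [Algebra k R]
    [AddCommGroup M] [Module k M] [Module R M] [IsScalarTower k R M] [FiniteDimensional k M]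
    (hres : ∀ r : R, ∃ c : k, r - algebraMap k R c ∈ IsLocalRing.maximalIdeal R) :
    (Module.length R M).toNat = Module.finrank k M := by
  have hloc : IsLocalHom (algebraMap k R) := inferInstance
  have h := IsLocalRing.length_restrictScalars k R M
  have hone : Module.length (IsLocalRing.ResidueField k) (IsLocalRing.ResidueField R) = 1 := by
    refine le_antisymm ?_ (Order.one_le_iff_pos.2 Module.length_pos)
    have hs : Function.Surjective (Algebra.linearMap (IsLocalRing.ResidueField k)
        (IsLocalRing.ResidueField R)) := fun y => by
      obtain ⟨r, rfl⟩ := IsLocalRing.residue_surjective y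
      obtain ⟨c, hc⟩ := hres r
      refine ⟨IsLocalRing.residue k c, ?_⟩
      rw [← IsLocalRing.residue_eq_zero_iff, map_sub, sub_eq_zero] at hc
      rw [hc]
      rfl
    refine (Module.length_le_of_surjective _ hs).trans ?_
    rw [Module.length_eq_finrank]
    simp
  rw [hone, mul_one, Module.length_eq_finrank] at h
  rw [← h]
  simp

lemma frobeniusPower_span_range {R ι : Type*} [CommRing R] [Finite ι] (p e : ℕ) [ExpChar R p]
    (g : ι → R) :
    frobeniusPower (Ideal.span (Set.range g)) (p ^ e) =
      Ideal.span (Set.range fun i => g i ^ p ^ e) := by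
  have := Fintype.ofFinite ι
  refine le_antisymm (Ideal.span_le.2 ?_) (Ideal.span_le.2 ?_)
  · rintro _ ⟨x, hx, rfl⟩
    obtain ⟨c, rfl⟩ := Ideal.mem_span_range_iff_exists_fun.1 hx
    simp only [sum_pow_char_pow, mul_pow]
    exact sum_mem fun i _ => Ideal.mul_mem_left _ _ (Ideal.subset_span ⟨i, rfl⟩)
  · rintro _ ⟨i, rfl⟩
    exact Ideal.subset_span ⟨g i, Ideal.subset_span ⟨i, rfl⟩, rfl⟩

lemma maximalIdeal_quadricRing (k : Type*) [Field k] (d : ℕ) :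
    IsLocalRing.maximalIdeal (QuadricRing k d) = Ideal.span (Set.range fun i =>
      Ideal.Quotient.mk (Ideal.span {quadricForm k d}) (MvPowerSeries.X i)) := by
  have h := IsLocalRing.map_maximalIdeal_of_surjective
    (Ideal.Quotient.mk (Ideal.span {quadricForm k d})) Ideal.Quotient.mk_surjective
  rw [← h, maximalIdeal_mvPowerSeries, Ideal.map_span, ← Set.range_comp]
  rfl

/-- The image of `(x_0 ^ q, …, x_d ^ q)` in the quadric ring. -/
def quadricTruncIdeal (k : Type*) [Field k] (d q : ℕ) : Ideal (QuadricRing k d) :=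
  (truncIdealPS k (d + 1) q).map (Ideal.Quotient.mk (Ideal.span {quadricForm k d}))

lemma frobeniusPower_maximalIdeal_quadricRing (d p e : ℕ) [CharP k p] [Fact p.Prime] :
    frobeniusPower (IsLocalRing.maximalIdeal (QuadricRing k d)) (p ^ e) =
      quadricTruncIdeal k d (p ^ e) := by
  have : ExpChar k p := .prime Fact.out
  have : ExpChar (QuadricRing k d) p :=
    expChar_of_injective_algebraMap (algebraMap k _).injective p
  rw [maximalIdeal_quadricRing, frobeniusPower_span_range, quadricTruncIdeal, truncIdealPS,
    Ideal.map_span, ← Set.range_comp]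
  simp [Function.comp_def]

/-- The quadric as a polynomial. -/
def quadricPoly (k : Type*) [Field k] (n : ℕ) : MvPolynomial (Fin n) k :=
  ∑ i, MvPolynomial.X i ^ 2

lemma mk_quadricPoly : Ideal.Quotient.mk (truncIdeal k n q) (quadricPoly k n) =
    truncQuadric k n q := by
  simp [quadricPoly, truncQuadric, truncX]

lemma coe_quadricPoly (d : ℕ) :
    (quadricPoly k (d + 1) : MvPowerSeries (Fin (d + 1)) k) = quadricForm k d := by
  change MvPolynomial.coeToMvPowerSeries.ringHom _ = _
  rw [quadricPoly, map_sum]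
  simp [quadricForm]

lemma mk_mem_span_truncQuadric {f : MvPolynomial (Fin n) k} :
    Ideal.Quotient.mk (truncIdeal k n q) f ∈ Ideal.span {truncQuadric k n q} ↔
      ∃ g, f - quadricPoly k n * g ∈ truncIdeal k n q := by
  rw [Ideal.mem_span_singleton, ← mk_quadricPoly]
  constructor
  · rintro ⟨g, hg⟩
    obtain ⟨g, rfl⟩ := Ideal.Quotient.mk_surjective g
    exact ⟨g, by rwa [← map_mul, Ideal.Quotient.eq] at hg⟩
  · rintro ⟨g, hg⟩
    exact ⟨Ideal.Quotient.mk _ g, by rwa [← map_mul, Ideal.Quotient.eq]⟩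

lemma coe_sub_quadricPoly_mul {d : ℕ} (f g : MvPolynomial (Fin (d + 1)) k) :
    ((f - quadricPoly k (d + 1) * g : MvPolynomial (Fin (d + 1)) k) :
      MvPowerSeries (Fin (d + 1)) k) = f - quadricForm k d * g := by
  rw [← coe_quadricPoly]
  simp only [← MvPolynomial.coeToMvPowerSeries.ringHom_apply, map_sub, map_mul]

lemma mk_coe_mem_quadricTruncIdeal {d : ℕ} {f : MvPolynomial (Fin (d + 1)) k} :
    Ideal.Quotient.mk (Ideal.span {quadricForm k d}) (f : MvPowerSeries (Fin (d + 1)) k) ∈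
      quadricTruncIdeal k d q ↔
        ∃ g, f - quadricPoly k (d + 1) * g ∈ truncIdeal k (d + 1) q := by
  rw [quadricTruncIdeal, Ideal.mem_map_iff_of_surjective _ Ideal.Quotient.mk_surjective]
  simp only [← coe_mem_truncIdealPS]
  constructor
  · rintro ⟨y, hy, hyf⟩
    rw [eq_comm, Ideal.Quotient.eq, Ideal.mem_span_singleton] at hyf
    obtain ⟨g, hg⟩ := hyf
    obtain ⟨g', hg'⟩ := exists_sub_coe_mem_truncIdealPS q g
    refine ⟨g', ?_⟩
    have : ((f - quadricPoly k (d + 1) * g' : MvPolynomial (Fin (d + 1)) k) :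
        MvPowerSeries (Fin (d + 1)) k) = y + quadricForm k d * (g - g') := by
      rw [coe_sub_quadricPoly_mul]
      linear_combination hg
    rw [this]
    exact add_mem hy (Ideal.mul_mem_left _ _ hg')
  · rintro ⟨g, hg⟩
    refine ⟨_, hg, ?_⟩
    rw [Ideal.Quotient.eq, Ideal.mem_span_singleton, coe_sub_quadricPoly_mul]
    exact ⟨-(g : MvPowerSeries (Fin (d + 1)) k), by ring⟩

/-- Power series may be replaced by polynomials modulo `(x_0 ^ q, …, x_d ^ q)`. -/
def quadricTruncEquiv (k : Type*) [Field k] (d q : ℕ) :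
    (TruncRing k (d + 1) q ⧸ Ideal.span {truncQuadric k (d + 1) q}) ≃ₗ[k]
      (QuadricRing k d ⧸ quadricTruncIdeal k d q) :=
  let α : MvPolynomial (Fin (d + 1)) k →ₗ[k]
      (TruncRing k (d + 1) q ⧸ Ideal.span {truncQuadric k (d + 1) q}) :=
    (Ideal.Quotient.mkₐ k _).toLinearMap ∘ₗ (Ideal.Quotient.mkₐ k _).toLinearMap
  let β : MvPolynomial (Fin (d + 1)) k →ₗ[k] (QuadricRing k d ⧸ quadricTruncIdeal k d q) :=
    (Ideal.Quotient.mkₐ k _).toLinearMap ∘ₗ (Ideal.Quotient.mkₐ k _).toLinearMap ∘ₗ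
      (MvPolynomial.coeToMvPowerSeries.algHom k).toLinearMap
  have hα : Function.Surjective α :=
    Ideal.Quotient.mk_surjective.comp Ideal.Quotient.mk_surjective
  have hβ : Function.Surjective β := fun y => by
    obtain ⟨y, rfl⟩ := Ideal.Quotient.mk_surjective y
    obtain ⟨y, rfl⟩ := Ideal.Quotient.mk_surjective y
    obtain ⟨g, hg⟩ := exists_sub_coe_mem_truncIdealPS q y
    refine ⟨g, Eq.symm (Ideal.Quotient.eq.2 ?_)⟩
    have := Ideal.mem_map_of_mem (Ideal.Quotient.mk (Ideal.span {quadricForm k d})) hg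
    rw [map_sub] at this
    exact this
  have hker : LinearMap.ker α = LinearMap.ker β := by
    ext f
    rw [LinearMap.mem_ker, LinearMap.mem_ker]
    refine (Ideal.Quotient.eq_zero_iff_mem.trans mk_mem_span_truncQuadric).trans
      (Iff.symm (Iff.trans ?_ mk_coe_mem_quadricTruncIdeal))
    refine Iff.trans ?_ Ideal.Quotient.eq_zero_iff_mem
    simp [β]
  (LinearMap.quotKerEquivOfSurjective α hα).symm.trans
    ((Submodule.quotEquivOfEq _ _ hker).trans (LinearMap.quotKerEquivOfSurjective β hβ))

lemma hilbertKunzSeq_quadricRing (d p e : ℕ) [CharP k p] [Fact p.Prime] :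
    hilbertKunzSeq (QuadricRing k d) p e =
      (corank k (truncQuadric k (d + 1) (p ^ e)) : ℝ) / ((p : ℝ) ^ e) ^ d := by
  have : FiniteDimensional k
      (TruncRing k (d + 1) (p ^ e) ⧸ Ideal.span {truncQuadric k (d + 1) (p ^ e)}) :=
    Module.Finite.of_surjective (Ideal.Quotient.mkₐ k _).toLinearMap Ideal.Quotient.mk_surjective
  have : FiniteDimensional k (QuadricRing k d ⧸ quadricTruncIdeal k d (p ^ e)) :=
    Module.Finite.equiv (quadricTruncEquiv k d (p ^ e))
  rw [hilbertKunzSeq, krullDimNat_quadricRing, frobeniusPower_maximalIdeal_quadricRing, pow_mul,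
    length_toNat_eq_finrank (k := k), ← (quadricTruncEquiv k d (p ^ e)).finrank_eq]
  · rfl
  · intro r
    obtain ⟨f, rfl⟩ := Ideal.Quotient.mk_surjective r
    refine ⟨MvPowerSeries.constantCoeff f, ?_⟩
    change Ideal.Quotient.mk _ (f - MvPowerSeries.C (MvPowerSeries.constantCoeff f)) ∈ _
    rw [← IsLocalRing.map_maximalIdeal_of_surjective _ Ideal.Quotient.mk_surjective]
    refine Ideal.mem_map_of_mem _ ?_
    rw [IsLocalRing.mem_maximalIdeal, mem_nonunits_iff, MvPowerSeries.isUnit_iff_constantCoeff]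
    simp

end PowerSeries

/-! ### Convergence and strict monotonicity -/

section Limit

variable {k : Type*} [Field k]

/-- The Hilbert--Kunz function of the quadric grows at least like a polynomial of degree `n`:
`f ^ r`, for `r` a power of the characteristic, is the image of `f` under the Frobenius-like
inclusion, and its corank is at most `r` times that of `f`. -/
lemma pow_mul_corank_truncQuadric_le (n q p e : ℕ) [CharP k p] [Fact p.Prime] :
    (p ^ e) ^ n * corank k (truncQuadric k (n + 1) q) ≤
      corank k (truncQuadric k (n + 1) (q * p ^ e)) := by
  have hr0 : 0 < p ^ e := pow_pos (Nat.Prime.pos Fact.out) e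
  have h1 := corank_truncQuadric_pow_mul (k := k) (n := n + 1) (q := q) p e 1
  have h2 := corank_pow_le (k := k) (truncQuadric k (n + 1) (q * p ^ e)) (p ^ e)
  rw [mul_one, pow_one] at h1
  rw [h1, pow_succ', mul_assoc] at h2
  exact le_of_mul_le_mul_left h2 hr0

/-- A small Jordan block at the level `q₀ = 2 h + 1` costs `2 r ^ (d + 1)` dimensions at the level
`q₀ r`. -/
lemma corank_truncQuadric_succ_add_le {d h s p e : ℕ} [CharP k p] [Fact p.Prime] (hd : 1 ≤ d)
    (hh : 2 ≤ h) (hk : ((2 * h + 1 : ℕ) : k) = 0) (hs : p ^ e = 2 * s + 1) :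
    corank k (truncQuadric k (d + 2) ((2 * h + 1) * p ^ e)) + 2 * (p ^ e) ^ (d + 1) ≤
      (2 * h + 1) * p ^ e * corank k (truncQuadric k (d + 1) ((2 * h + 1) * p ^ e)) := by
  have hq : (2 * h + 1) * p ^ e = 2 * (p ^ e * h + s) + 1 := by rw [hs]; ring
  have h1 := corank_truncQuadric_succ_le (k := k) (n := d + 1) (p ^ e * h + s)
  rw [← hq, add_assoc (p ^ e * h)] at h1
  change corank k (truncQuadric k (d + 2) _) ≤ _ at h1
  set f := truncQuadric k (d + 1) ((2 * h + 1) * p ^ e) with hf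
  have h2 := corank_pow_add_le (k := k) f (p ^ e * h) (s + 1)
  have h3 := corank_pow_add_le (k := k) f (p ^ e * h) s
  have h4 : corank k (f ^ (p ^ e * h)) = _ :=
    corank_truncQuadric_pow_mul (k := k) (n := d + 1) (q := 2 * h + 1) p e h
  have h5 := corank_truncQuadric_pow_lt (n := d + 1) (by omega) hh hk
  have h6 := pow_mul_corank_truncQuadric_le (k := k) d (2 * h + 1) p e
  rw [← hf] at h6
  set D := corank k f
  set D₀ := corank k (truncQuadric k (d + 1) (2 * h + 1))
  have h7 : corank k (f ^ (p ^ e * h)) + (p ^ e) ^ (d + 1) ≤ p ^ e * h * D := by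
    calc _ = (p ^ e) ^ (d + 1) * (corank k (truncQuadric k (d + 1) (2 * h + 1) ^ h) + 1) := by
          rw [h4]; ring
      _ ≤ (p ^ e) ^ (d + 1) * (h * D₀) := Nat.mul_le_mul_left _ h5
      _ = p ^ e * h * ((p ^ e) ^ d * D₀) := by ring
      _ ≤ p ^ e * h * D := Nat.mul_le_mul_left _ h6
  have h8 : (2 * h + 1) * p ^ e * D = 2 * (p ^ e * h * D) + (s + 1) * D + s * D := by
    rw [show (2 * h + 1) * p ^ e = 2 * (p ^ e * h) + (2 * s + 1) by rw [← hs]; ring]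
    ring
  omega

lemma monotone_hilbertKunzSeq (d p : ℕ) [CharP k p] [Fact p.Prime] :
    Monotone (hilbertKunzSeq (QuadricRing k d) p) := by
  refine monotone_nat_of_le_succ fun e => ?_
  have hp : 0 < (p : ℝ) := by exact_mod_cast Nat.Prime.pos (Fact.out : p.Prime)
  rw [hilbertKunzSeq_quadricRing, hilbertKunzSeq_quadricRing,
    div_le_div_iff₀ (by positivity) (by positivity)]
  have h : ((p ^ 1 : ℕ) : ℝ) ^ d * corank k (truncQuadric k (d + 1) (p ^ e)) ≤
      corank k (truncQuadric k (d + 1) (p ^ e * p ^ 1)) := by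
    exact_mod_cast pow_mul_corank_truncQuadric_le (k := k) d (p ^ e) p 1
  rw [pow_one, ← pow_succ] at h
  calc _ = (p : ℝ) ^ d * corank k (truncQuadric k (d + 1) (p ^ e)) * ((p : ℝ) ^ e) ^ d := by
        rw [pow_succ, mul_pow]; ring
    _ ≤ _ := by gcongr

lemma hilbertKunzSeq_le_two {d p : ℕ} [CharP k p] [Fact p.Prime] (hp : 2 < p) (e : ℕ) :
    hilbertKunzSeq (QuadricRing k d) p e ≤ 2 := by
  have hp0 : 0 < (p : ℝ) := by exact_mod_cast (by omega : 0 < p)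
  obtain ⟨s, hs⟩ := ((Fact.out : p.Prime).odd_of_ne_two hp.ne').pow (n := e)
  rw [hilbertKunzSeq_quadricRing, div_le_iff₀ (by positivity)]
  have h := corank_truncQuadric_succ_le_two_mul (k := k) (n := d) s
  rw [← hs] at h
  exact_mod_cast h

lemma tendsto_hilbertKunzSeq_quadricRing (d : ℕ) {p : ℕ} [CharP k p] [Fact p.Prime] (hp : 2 < p) :
    Tendsto (hilbertKunzSeq (QuadricRing k d) p) atTop
      (𝓝 (hilbertKunzMultiplicity (QuadricRing k d) p)) := by
  have h := tendsto_atTop_ciSup (monotone_hilbertKunzSeq (k := k) d p)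
    ⟨2, by rintro _ ⟨e, rfl⟩; exact hilbertKunzSeq_le_two hp e⟩
  rwa [hilbertKunzMultiplicity, h.limUnder_eq]

lemma hilbertKunzSeq_succ_add_le {d p : ℕ} [CharP k p] [Fact p.Prime] (hp : 2 < p) (hd : 1 ≤ d)
    (e : ℕ) :
    hilbertKunzSeq (QuadricRing k (d + 1)) p (2 + e) + 2 / ((p : ℝ) ^ 2) ^ (d + 1) ≤
      hilbertKunzSeq (QuadricRing k d) p (2 + e) := by
  have hp0 : 0 < (p : ℝ) := by exact_mod_cast (by omega : 0 < p)
  have hodd := (Fact.out : p.Prime).odd_of_ne_two hp.ne'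
  obtain ⟨s, hs⟩ := hodd.pow (n := e)
  -- At the level `p` itself the case `p = 3` would give `h = 1`, which leaves no smaller block.
  obtain ⟨h, hh⟩ := hodd.pow (n := 2)
  have hh2 : 2 ≤ h := by nlinarith
  have hk : ((2 * h + 1 : ℕ) : k) = 0 := by
    rw [← hh, Nat.cast_pow, CharP.cast_eq_zero, zero_pow two_ne_zero]
  have key := corank_truncQuadric_succ_add_le (k := k) hd hh2 hk hs
  rw [← hh, ← pow_add] at key
  have key' : (corank k (truncQuadric k (d + 2) (p ^ (2 + e))) : ℝ) + 2 * ((p : ℝ) ^ e) ^ (d + 1) ≤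
      (p : ℝ) ^ (2 + e) * corank k (truncQuadric k (d + 1) (p ^ (2 + e))) := by
    exact_mod_cast key
  rw [hilbertKunzSeq_quadricRing, hilbertKunzSeq_quadricRing]
  calc _ = ((corank k (truncQuadric k (d + 2) (p ^ (2 + e))) : ℝ) +
          2 * ((p : ℝ) ^ e) ^ (d + 1)) / ((p : ℝ) ^ (2 + e)) ^ (d + 1) := by
        rw [add_div, pow_add (p : ℝ) 2 e, mul_pow ((p : ℝ) ^ 2),
          mul_div_mul_right _ _ (by positivity)]
    _ ≤ ((p : ℝ) ^ (2 + e) * corank k (truncQuadric k (d + 1) (p ^ (2 + e)))) /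
          ((p : ℝ) ^ (2 + e)) ^ (d + 1) := by gcongr
    _ = _ := by
        rw [pow_succ' ((p : ℝ) ^ (2 + e)) d, mul_div_mul_left _ _ (by positivity)]

end Limit

end

theorem mainTheorem2 {k : Type*} [Field k] (p : ℕ) [CharP k p] (hp : 2 < p)
    (d : ℕ) (hd : 1 ≤ d) :
    Tendsto (hilbertKunzSeq (QuadricRing k d) p) atTop
        (𝓝 (hilbertKunzMultiplicity (QuadricRing k d) p)) ∧
      Tendsto (hilbertKunzSeq (QuadricRing k (d + 1)) p) atTop
        (𝓝 (hilbertKunzMultiplicity (QuadricRing k (d + 1)) p)) ∧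
      hilbertKunzMultiplicity (QuadricRing k d) p >
        hilbertKunzMultiplicity (QuadricRing k (d + 1)) p := by
  have : Fact p.Prime := ⟨CharP.char_prime_of_ne_zero k (by omega)⟩
  have h1 := tendsto_hilbertKunzSeq_quadricRing (k := k) d hp
  have h2 := tendsto_hilbertKunzSeq_quadricRing (k := k) (d + 1) hp
  refine ⟨h1, h2, ?_⟩
  have hshift : Tendsto (fun e => 2 + e) atTop atTop := tendsto_atTop_mono (by simp) tendsto_id
  have h := le_of_tendsto_of_tendsto' ((h2.comp hshift).add_const (2 / ((p : ℝ) ^ 2) ^ (d + 1)))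
    (h1.comp hshift) fun e => hilbertKunzSeq_succ_add_le hp hd e
  have : 0 < 2 / ((p : ℝ) ^ 2) ^ (d + 1) := by
    have : 0 < (p : ℝ) := by exact_mod_cast (by omega : 0 < p)
    positivity
  linarith
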